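/- Theorem. Let $r,s$ be natural numbers with $1<s\le r<2s-1$. For a sequence of digits $\alpha_n\in A=\{0,1,\dots,r\}$ write $\Delta^{r_s}_{\alpha_1\alpha_2\dots}=\sum_{n\ge 1}\alpha_n s^{-n}$; the sequence $(\alpha_n)$ is called an $r_s$-representation of this number. Parentheses denote a period, and $a^k$ denotes $k$ consecutive digits $a$, $k\ge0$. Similarly write $\Delta^{r+1}_{\alpha_1\alpha_2\dots}=\sum_{n\ge1}\alpha_n(r+1)^{-n}$. Let $f:[0,1]\to\mathbb R$ be defined by $$f\bigl(\Delta^{r+1}_{\alpha_1\alpha_2\dots}\bigr)=\Delta^{r_s}_{\alpha_1\alpha_2\dots},$$ where, for a number with two representations in base $r+1$, the one with period $(0)$ is used, and where $f(1)=f(\Delta^{r+1}_{(r)})=\Delta^{r_s}_{(r)}=\frac r{s-1}$. For $y\in\mathbb R$ put $f^{-1}(y)=\{x\in[0,1]: f(x)=y\}$. Then: 1. $f$ has a level set that is a singleton; if moreover $r<2s-2$, then $f$ has a finite level set with at least two points. 2. $f$ has a countably infinite level set, namely $f^{-1}(\Delta^{r_s}_{(s-1)})$, and a level set of the cardinality of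 the continuum. 3. $f$ has a level set of positive Hausdorff dimension. 4. The set of all values $y\in f([0,1])$ whose level set $f^{-1}(y)$ is finite or countable has Hausdorff dimension $\dfrac{\ln(2s-r-1)}{\ln s}$. 5. Each of the numbers $\Delta^{r_s}_{(s-1)}$ and $\Delta^{r_s}_{(r-s+1)}$ has exactly countably infinitely many $r_s$-representations. The $r_s$-representations of $\Delta^{r_s}_{(s-1)}$ are exactly $(s-1)$ and $[s-1]^k\,s\,(0)$ for $k\ge 0$, and, if $r=2s-2$, additionally $[s-1]^k\,[s-2]\,(r)$ for $k\ge0$. The $r_s$-representations of $\Delta^{r_s}_{(r-s+1)}$ are exactly $(r-s+1)$ and $[r-s+1]^k\,[r-s]\,(r)$ for $k\ge0$, and, if $r=2s-2$, additionally $[r-s+1]^k\,[r-s+2]\,(0)$ for $k\ge0$. The level set $f^{-1}(\Delta^{r_s}_{(r-s+1)})$ is the singleton $\{\Delta^{r+1}_{(r-s+1)}\}$ if $r<2s-2$, and it is countably infinite if $r=2s-2$. -/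

import Mathlib

open Set Cardinal

noncomputable section

namespace RedundantDigits

/-- The number `∑_{n ≥ 1} α_n / b ^ n`. The digits `α_1, α_2, …` are `α 0, α 1, …`. -/
def value (b : ℕ) (α : ℕ → ℕ) : ℝ := ∑' n : ℕ, (α n : ℝ) / (b : ℝ) ^ (n + 1)

/-- The set of all representations of `y` in base `s` with digits `0, 1, …, r`. -/
def representations (r s : ℕ) (y : ℝ) : Set (ℕ → ℕ) :=
  {α | (∀ n, α n ≤ r) ∧ value s α = y}

/-- The digits of `x ∈ [0, 1]` in the classical base `r + 1`: of two representations the one with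
period `(0)` is used, and `1` has the digits `r, r, r, …`. -/
def classicalDigits (r : ℕ) (x : ℝ) : ℕ → ℕ :=
  fun n => if x = 1 then r else (Real.digits x (r + 1) n : ℕ)

/-- The function `f` on `[0, 1]`: the classical digits of `x` in base `r + 1` are read in
base `s`. -/
def f (r s : ℕ) (x : ℝ) : ℝ := value s (classicalDigits r x)

/-- The level set of `f` at the value `y`. -/
def levelSet (r s : ℕ) (y : ℝ) : Set ℝ := {x | x ∈ Icc (0 : ℝ) 1 ∧ f r s x = y}

/-- The sequence of digits `(c)`, that is `c, c, c, …`. -/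
def const (c : ℕ) : ℕ → ℕ := fun _ => c

/-- The sequence of digits that has `k` times `a`, then once `b`, then period `(c)`. -/
def word (k a b c : ℕ) : ℕ → ℕ := fun n => if n < k then a else if n = k then b else c

/-! Consistency of the definition of `f` with `f (∑ α_n / (r + 1) ^ n) = ∑ α_n / s ^ n`. -/

theorem value_eq_ofDigits (r : ℕ) (a : ℕ → Fin (r + 1)) :
    value (r + 1) (fun n => (a n : ℕ)) = Real.ofDigits a := by
  simp [value, Real.ofDigits, Real.ofDigitsTerm, div_eq_mul_inv]

theorem ofDigits_lt_one {r : ℕ} (hr : 1 ≤ r) (a : ℕ → Fin (r + 1)) (n : ℕ)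
    (hn : (a n : ℕ) ≠ r) : Real.ofDigits a < 1 := by
  have h1 : Real.ofDigits (fun _ : ℕ => Fin.last r) = 1 := by
    exact Real.ofDigits_const_last_eq_one' (b := r + 1) (by omega)
  rw [← h1, Real.ofDigits, Real.ofDigits]
  have hle : ∀ m, (a m : ℝ) ≤ ((Fin.last r : Fin (r + 1)) : ℕ) := by
    intro m
    exact_mod_cast Fin.le_last (a m)
  refine Summable.tsum_lt_tsum (i := n) (fun m => ?_) ?_
    Real.summable_ofDigitsTerm Real.summable_ofDigitsTerm
  · exact mul_le_mul_of_nonneg_right (hle m) (by positivity)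
  · have h2 : ((a n : ℕ) : ℝ) < ((Fin.last r : Fin (r + 1)) : ℕ) := by
      have := (a n).isLt
      simp only [Fin.val_last]
      exact_mod_cast (by omega : (a n : ℕ) < r)
    exact mul_lt_mul_of_pos_right h2 (by positivity)

theorem pow_mul_sum_ofDigitsTerm {r : ℕ} (a : ℕ → Fin (r + 1)) (n : ℕ) :
    ∃ N : ℕ, ((r + 1 : ℕ) : ℝ) ^ n *
      ∑ i ∈ Finset.range n, Real.ofDigitsTerm a i = N := by
  induction n with
  | zero => exact ⟨0, by simp⟩
  | succ n ih =>
    obtain ⟨N, hN⟩ := ih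
    refine ⟨(r + 1) * N + a n, ?_⟩
    have hb : ((r + 1 : ℕ) : ℝ) ≠ 0 := by positivity
    rw [Finset.sum_range_succ, mul_add, pow_succ', mul_assoc, hN, Real.ofDigitsTerm, ← pow_succ',
      mul_left_comm, mul_inv_cancel₀ (pow_ne_zero _ hb)]
    push_cast
    ring

theorem digits_ofDigits {r : ℕ} (hr : 1 ≤ r) (a : ℕ → Fin (r + 1))
    (h : ∀ N, ∃ n, N ≤ n ∧ (a n : ℕ) ≠ r) : Real.digits (Real.ofDigits a) (r + 1) = a := by
  funext i
  obtain ⟨N, hN⟩ := pow_mul_sum_ofDigitsTerm a i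
  obtain ⟨m, hm, hma⟩ := h (i + 1)
  set t := Real.ofDigits (fun j => a (j + (i + 1))) with ht
  have ht0 : 0 ≤ t := Real.ofDigits_nonneg _
  have ht1 : t < 1 := ofDigits_lt_one hr _ (m - (i + 1)) (by
    rwa [show m - (i + 1) + (i + 1) = m by omega])
  have hb : ((r + 1 : ℕ) : ℝ) ≠ 0 := by positivity
  have key : Real.ofDigits a * ((r + 1 : ℕ) : ℝ) ^ (i + 1)
      = (((r + 1) * N + (a i : ℕ) : ℕ) : ℝ) + t := by
    rw [Real.ofDigits_eq_sum_add_ofDigits a (i + 1), ← ht, add_mul, mul_comm _ t, mul_assoc t,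
      inv_mul_cancel₀ (pow_ne_zero _ hb), mul_one, Finset.sum_range_succ, mul_comm, mul_add,
      pow_succ', mul_assoc, hN, Real.ofDigitsTerm, ← pow_succ', mul_left_comm,
      mul_inv_cancel₀ (pow_ne_zero _ hb)]
    push_cast
    ring
  have hfl : ⌊Real.ofDigits a * ((r + 1 : ℕ) : ℝ) ^ (i + 1)⌋₊ = (r + 1) * N + (a i : ℕ) := by
    rw [key, Nat.floor_eq_iff (by positivity)]
    constructor <;> linarith
  apply Fin.ext
  simp only [Real.digits, hfl, Fin.val_ofNat, Nat.mul_add_mod]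
  exact Nat.mod_eq_of_lt (a i).isLt

/-- `f` takes `∑ α_n / (r + 1) ^ n` to `∑ α_n / s ^ n` if the digits `α_n` do not end in the
period `(r)`. -/
theorem f_value {r s : ℕ} (hr : 1 ≤ r) (α : ℕ → ℕ) (hα : ∀ n, α n ≤ r)
    (h : ∀ N, ∃ n, N ≤ n ∧ α n ≠ r) : f r s (value (r + 1) α) = value s α := by
  set a : ℕ → Fin (r + 1) := fun n => ⟨α n, by have := hα n; omega⟩ with ha
  have h1 : value (r + 1) α = Real.ofDigits a := value_eq_ofDigits r a
  obtain ⟨n, -, hn⟩ := h 0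
  have h2 : Real.ofDigits a ≠ 1 := (ofDigits_lt_one hr a n hn).ne
  have h3 : classicalDigits r (Real.ofDigits a) = α := by
    funext n
    simp only [classicalDigits, if_neg h2]
    rw [digits_ofDigits hr a h]
  rw [f, h1, h3]

/-- `f` takes the right endpoint `1` to `∑ r / s ^ n`. -/
theorem f_one (r s : ℕ) : f r s 1 = value s (const r) := by
  have h : classicalDigits r 1 = const r := by
    funext n
    simp [classicalDigits, const]
  rw [f, h]

end RedundantDigits

end

namespace RedundantDigits

/-! Put `M = r / (s - 1)`, the largest value of a digit sequence; the hypotheses give `1 < M ≤ 2`,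
and every number in `[0, M]` has a representation (`exists_value_eq`). Raising a digit by one is
paid for by lowering the value of the remaining digits by one. This is possible when that tail value
is at least `1`, and the opposite move when it is at most `M - 1`; strictly between, neither
neighbouring digit can be used.

If all digits of `w` lie between `r - s + 1` and `s - 1`, all its tails have values in `[M - 1, 1]`.
A second representation can then leave `w` only where a tail attains an endpoint, and it must
continue with `(0)` or `(r)` (`eq_or_deviates`). So there are countably many representations, and
for constant `w` they can be listed.

Conversely, a nonempty countable set of representations is closed but not perfect, so one of its
members has a tail that is a unique representation (`exists_isUniqueRepresentation_tail`). Such a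
tail is `(0)`, `(r)`, or eventually has digits in the middle range (`IsUniqueRepresentation.cases`).
Hence the values with countable level sets contain `middleSet` and are covered by countably many
affine copies of `middleSet` with two points added. `middleSet` is a translate of a Cantor set of
numbers with `2s - 1 - r` digits in base `s`, which gives the dimension.

Level sets are injective images of the representations not ending in `(r)`, apart from `(r)` itself
(`levelSet_eq_image`); only countably many representations are lost. A large level set comes from `1
0` and `0 s` having equal value in base `s` but not in base `r + 1`. -/

/-! ### Values of digit sequences: monotonicity, shifts, grouping, continuity -/

theorem summable_value {b c : ℕ} (hb : 1 < b) {α : ℕ → ℕ} (hα : ∀ n, α n ≤ c) :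
    Summable fun n : ℕ => (α n : ℝ) / (b : ℝ) ^ (n + 1) := by
  have hb' : (1 : ℝ) < b := by exact_mod_cast hb
  have h : Summable fun n : ℕ => (c : ℝ) * ((b : ℝ)⁻¹) ^ (n + 1) :=
    ((summable_nat_add_iff 1).2
      (summable_geometric_of_lt_one (by positivity) (inv_lt_one_of_one_lt₀ hb'))).mul_left _
  refine Summable.of_nonneg_of_le (fun n => by positivity) (fun n => ?_) h
  rw [inv_pow, ← div_eq_mul_inv]
  gcongr
  exact_mod_cast hα n

theorem value_const {b : ℕ} (hb : 1 < b) (c : ℕ) : value b (const c) = c / ((b : ℝ) - 1) := by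
  have hb' : (1 : ℝ) < b := by exact_mod_cast hb
  have h : HasSum (fun n : ℕ => (c / b : ℝ) * ((b : ℝ)⁻¹) ^ n) ((c / b : ℝ) * (1 - (b : ℝ)⁻¹)⁻¹) :=
    (hasSum_geometric_of_lt_one (by positivity) (inv_lt_one_of_one_lt₀ hb')).mul_left _
  have h2 : value b (const c) = (c / b : ℝ) * (1 - (b : ℝ)⁻¹)⁻¹ := by
    rw [← h.tsum_eq, value]
    refine tsum_congr fun n => ?_
    simp only [const]
    rw [inv_pow, pow_succ']
    field_simp
  have : (b : ℝ) - 1 ≠ 0 := by linarith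
  rw [h2]
  field_simp

theorem value_nonneg (b : ℕ) (α : ℕ → ℕ) : 0 ≤ value b α :=
  tsum_nonneg fun n => by positivity

theorem value_mono {b c : ℕ} (hb : 1 < b) {α β : ℕ → ℕ} (hβ : ∀ n, β n ≤ c)
    (h : ∀ n, α n ≤ β n) : value b α ≤ value b β := by
  refine Summable.tsum_le_tsum (fun n => ?_)
    (summable_value hb fun n => (h n).trans (hβ n)) (summable_value hb hβ)
  gcongr
  exact_mod_cast h n

theorem value_strict_mono {b c : ℕ} (hb : 1 < b) {α β : ℕ → ℕ} (hβ : ∀ n, β n ≤ c)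
    (h : ∀ n, α n ≤ β n) {m : ℕ} (hm : α m < β m) : value b α < value b β := by
  refine Summable.tsum_lt_tsum (i := m) (fun n => ?_) ?_
    (summable_value hb fun n => (h n).trans (hβ n)) (summable_value hb hβ)
  · gcongr
    exact_mod_cast h n
  · gcongr

theorem value_le {b c : ℕ} (hb : 1 < b) {α : ℕ → ℕ} (hα : ∀ n, α n ≤ c) :
    value b α ≤ c / ((b : ℝ) - 1) := by
  rw [← value_const hb]
  exact value_mono (c := c) hb (fun _ => le_rfl) hα

theorem le_value {b c d : ℕ} (hb : 1 < b) {α : ℕ → ℕ} (hα : ∀ n, α n ≤ c) (h : ∀ n, d ≤ α n) :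
    d / ((b : ℝ) - 1) ≤ value b α := by
  rw [← value_const hb]
  exact value_mono hb hα h

theorem eq_of_value_eq_of_le {b c : ℕ} (hb : 1 < b) {α β : ℕ → ℕ} (hβ : ∀ n, β n ≤ c)
    (h : ∀ n, α n ≤ β n) (hv : value b α = value b β) : α = β := by
  by_contra hne
  obtain ⟨m, hm⟩ := Function.ne_iff.1 hne
  exact (value_strict_mono hb hβ h (lt_of_le_of_ne (h m) hm)).ne hv

theorem eq_const_of_value_eq_max {b c : ℕ} (hb : 1 < b) {α : ℕ → ℕ} (hα : ∀ n, α n ≤ c)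
    (h : value b α = c / ((b : ℝ) - 1)) (n : ℕ) : α n = c :=
  congrFun (eq_of_value_eq_of_le (β := const c) hb (fun _ => le_rfl) hα
    (h.trans (value_const hb c).symm)) n

theorem eq_const_of_value_eq_min {b c d : ℕ} (hb : 1 < b) {α : ℕ → ℕ} (hα : ∀ n, α n ≤ c)
    (hd : ∀ n, d ≤ α n) (h : value b α = d / ((b : ℝ) - 1)) (n : ℕ) : α n = d :=
  (congrFun (eq_of_value_eq_of_le (α := const d) hb hα hd
    ((value_const hb d).trans h.symm)) n).symm

theorem eq_zero_of_value_eq_zero {b c : ℕ} (hb : 1 < b) {α : ℕ → ℕ} (hα : ∀ n, α n ≤ c)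
    (h : value b α = 0) (n : ℕ) : α n = 0 :=
  eq_const_of_value_eq_min (d := 0) hb hα (fun _ => Nat.zero_le _) (by simp [h]) n

theorem value_eq_sum_add {b c : ℕ} (hb : 1 < b) {α : ℕ → ℕ} (hα : ∀ n, α n ≤ c) (N : ℕ) :
    value b α = ∑ i ∈ Finset.range N, (α i : ℝ) / (b : ℝ) ^ (i + 1) +
      value b (fun n => α (n + N)) / (b : ℝ) ^ N := by
  have hb' : (b : ℝ) ≠ 0 := by positivity
  rw [value, ← (summable_value hb hα).sum_add_tsum_nat_add N, value, ← tsum_div_const]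
  congr 1
  refine tsum_congr fun n => ?_
  rw [div_div, ← pow_add, add_right_comm]

/-- The value of a sequence in terms of its first digit and the remaining digits. -/
theorem mul_value {b c : ℕ} (hb : 1 < b) {α : ℕ → ℕ} (hα : ∀ n, α n ≤ c) :
    b * value b α = α 0 + value b (fun n => α (n + 1)) := by
  have hb' : (b : ℝ) ≠ 0 := by positivity
  rw [value_eq_sum_add hb hα 1]
  simp
  field_simp

theorem value_eq_iff_of_prefix {b c : ℕ} (hb : 1 < b) {α β : ℕ → ℕ} (hα : ∀ n, α n ≤ c)
    (hβ : ∀ n, β n ≤ c) {N : ℕ} (h : ∀ i < N, α i = β i) :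
    value b α = value b β ↔ value b (fun n => α (n + N)) = value b (fun n => β (n + N)) := by
  have hb' : (b : ℝ) ≠ 0 := by positivity
  rw [value_eq_sum_add hb hα N, value_eq_sum_add hb hβ N,
    Finset.sum_congr rfl fun i hi => by rw [h i (Finset.mem_range.1 hi)]]
  simp [div_left_inj' (pow_ne_zero N hb')]

/-- A number is recovered from a tail value by one of countably many affine maps, because the first
`N` digits enter only through an integer `K`. -/
theorem exists_pow_mul_value {b c : ℕ} (hb : 1 < b) {α : ℕ → ℕ} (hα : ∀ n, α n ≤ c) (N : ℕ) :
    ∃ K : ℕ, (b : ℝ) ^ N * value b α = K + value b (fun n => α (n + N)) := by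
  induction N with
  | zero => exact ⟨0, by simp⟩
  | succ N ih =>
    obtain ⟨K, hK⟩ := ih
    refine ⟨b * K + α N, ?_⟩
    have h := mul_value hb (α := fun n => α (n + N)) fun n => hα _
    rw [pow_succ', mul_assoc, hK, mul_add]
    simp only [zero_add, add_right_comm _ 1 N] at h ⊢
    rw [h]
    push_cast
    exact (add_assoc _ _ _).symm

theorem value_add {b c d : ℕ} (hb : 1 < b) {α β : ℕ → ℕ} (hα : ∀ n, α n ≤ c)
    (hβ : ∀ n, β n ≤ d) : value b (fun n => α n + β n) = value b α + value b β := by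
  rw [value, value, value, ← (summable_value hb hα).tsum_add (summable_value hb hβ)]
  refine tsum_congr fun n => ?_
  push_cast
  ring

theorem value_add_mul {b c : ℕ} (hb : 1 < b) {α : ℕ → ℕ} (hα : ∀ n, α n ≤ c) (k d : ℕ) :
    value b (fun n => k + d * α n) = value b (const k) + d * value b α := by
  rw [value, value, value, ← tsum_mul_left,
    ← (summable_value hb (α := const k) (c := k) fun _ => le_rfl).tsum_add
      ((summable_value hb hα).mul_left _)]
  refine tsum_congr fun n => ?_
  simp only [const]
  push_cast
  ring

/-- Grouping the digits in pairs. -/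
theorem value_eq_value_sq {b c : ℕ} (hb : 1 < b) {α : ℕ → ℕ} (hα : ∀ n, α n ≤ c) :
    value b α = value (b ^ 2) (fun n => b * α (2 * n) + α (2 * n + 1)) := by
  have hb' : (b : ℝ) ≠ 0 := by positivity
  have hs := summable_value hb hα
  have he : Function.Injective fun n : ℕ => 2 * n := fun m n h => by simpa using h
  have ho : Function.Injective fun n : ℕ => 2 * n + 1 := fun m n h => by simpa using h
  have h1 : Summable fun n : ℕ => (α (2 * n) : ℝ) / (b : ℝ) ^ (2 * n + 1) :=
    hs.comp_injective he
  have h2 : Summable fun n : ℕ => (α (2 * n + 1) : ℝ) / (b : ℝ) ^ (2 * n + 1 + 1) :=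
    hs.comp_injective ho
  have h3 := tsum_even_add_odd (f := fun n : ℕ => (α n : ℝ) / (b : ℝ) ^ (n + 1)) h1 h2
  rw [value, ← h3, ← h1.tsum_add h2, value]
  refine tsum_congr fun n => ?_
  push_cast
  rw [← pow_mul, show 2 * (n + 1) = 2 * n + 1 + 1 by ring, pow_succ _ (2 * n + 1)]
  field_simp

theorem continuousOn_value {b : ℕ} (hb : 1 < b) (c : ℕ) :
    ContinuousOn (value b) {α | ∀ n, α n ≤ c} := by
  refine continuousOn_tsum (fun n => Continuous.continuousOn ?_)
    (summable_value hb (α := const c) fun _ => le_rfl) fun n α hα => ?_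
  · exact ((continuous_of_discreteTopology (f := fun k : ℕ => (k : ℝ))).comp
      (continuous_apply n)).div_const _
  · rw [Real.norm_of_nonneg (by positivity)]
    simp only [const]
    gcongr
    exact_mod_cast hα n

/-! ### Rigidity of the middle digits -/

/-- A representation of a number that has a representation `w` with digits between `r - s + 1` and
`s - 1` leaves `w` at most once, and then ends in the period `(0)` or `(r)`. -/
theorem eq_or_deviates {r s : ℕ} (hs : 1 < s) (hsr : s ≤ r) {w β : ℕ → ℕ}
    (hw1 : ∀ n, r - s + 1 ≤ w n) (hw2 : ∀ n, w n ≤ s - 1)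
    (hβ : β ∈ representations r s (value s w)) :
    β = w ∨ ∃ k, (∀ j < k, β j = w j) ∧
      ((β k = w k + 1 ∧ ∀ j, k < j → β j = 0 ∧ w j = s - 1) ∨
        (β k + 1 = w k ∧ ∀ j, k < j → β j = r ∧ w j = r - s + 1)) := by
  classical
  by_cases hne : β = w
  · exact Or.inl hne
  right
  have hex := Function.ne_iff.1 hne
  have hk := Nat.find_spec hex
  have hmin : ∀ j < Nat.find hex, β j = w j := fun j hj => not_not.1 (Nat.find_min hex hj)
  set k := Nat.find hex with hkdef
  refine ⟨k, hmin, ?_⟩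
  have hs' : (1 : ℝ) < s := by exact_mod_cast hs
  have hwr : ∀ n, w n ≤ r := fun n => (hw2 n).trans (by omega)
  have hv := (value_eq_iff_of_prefix hs hβ.1 hwr hmin).1 hβ.2
  have e1 := mul_value hs (α := fun n => β (n + k)) fun n => hβ.1 _
  have e2 := mul_value hs (α := fun n => w (n + k)) fun n => hwr _
  rw [hv, e2] at e1
  simp only [zero_add] at e1
  set T := value s fun n => β (n + 1 + k) with hT
  set W := value s fun n => w (n + 1 + k) with hW
  have hT0 : 0 ≤ T := value_nonneg _ _
  have hT1 : T ≤ r / ((s : ℝ) - 1) := value_le hs fun n => hβ.1 _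
  have hW0 : ((r - s + 1 : ℕ) : ℝ) / ((s : ℝ) - 1) ≤ W := le_value hs (fun n => hwr _) fun n => hw1 _
  have hW1 : W ≤ ((s - 1 : ℕ) : ℝ) / ((s : ℝ) - 1) := value_le hs fun n => hw2 _
  have hs1 : (s : ℝ) - 1 ≠ 0 := by linarith
  -- With `M = r / (s - 1)`, the tail `W` lies in `[M - 1, 1]` and `T` in `[0, M]`. A digit
  -- difference of at least one therefore forces equality in all the bounds, and extreme values
  -- determine every digit.
  have c1 : ((s - 1 : ℕ) : ℝ) / ((s : ℝ) - 1) = 1 := by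
    rw [Nat.cast_sub hs.le, Nat.cast_one, div_self hs1]
  have c2 : ((r - s + 1 : ℕ) : ℝ) / ((s : ℝ) - 1) = r / ((s : ℝ) - 1) - 1 := by
    rw [Nat.cast_add, Nat.cast_sub hsr, Nat.cast_one]
    field_simp
    ring
  rcases lt_or_gt_of_ne hk with h | h
  · right
    have hge : (β k : ℝ) + 1 ≤ w k := by exact_mod_cast h
    have h1 : T = r / ((s : ℝ) - 1) := by linarith
    have h2 : W = ((r - s + 1 : ℕ) : ℝ) / ((s : ℝ) - 1) := by linarith
    have h3 : (β k : ℝ) + 1 = w k := by linarith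
    refine ⟨by exact_mod_cast h3, fun j hj => ?_⟩
    have t1 := eq_const_of_value_eq_max hs (fun n => hβ.1 _) h1 (j - 1 - k)
    have t2 := eq_const_of_value_eq_min hs (fun n => hwr _) (fun n => hw1 _) h2 (j - 1 - k)
    rw [show j - 1 - k + 1 + k = j by omega] at t1 t2
    exact ⟨t1, t2⟩
  · left
    have hge : (w k : ℝ) + 1 ≤ β k := by exact_mod_cast h
    have h1 : T = 0 := by linarith
    have h2 : W = ((s - 1 : ℕ) : ℝ) / ((s : ℝ) - 1) := by linarith
    have h3 : (β k : ℝ) = w k + 1 := by linarith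
    refine ⟨by exact_mod_cast h3, fun j hj => ?_⟩
    have t1 := eq_zero_of_value_eq_zero hs (fun n => hβ.1 _) h1 (j - 1 - k)
    have t2 := eq_const_of_value_eq_max hs (fun n => hw2 _) h2 (j - 1 - k)
    rw [show j - 1 - k + 1 + k = j by omega] at t1 t2
    exact ⟨t1, t2⟩

theorem countable_representations {r s : ℕ} (hs : 1 < s) (hsr : s ≤ r) {w : ℕ → ℕ}
    (hw1 : ∀ n, r - s + 1 ≤ w n) (hw2 : ∀ n, w n ≤ s - 1) :
    (representations r s (value s w)).Countable := by
  -- A deviating representation is encoded by the place of deviation, the digit there and the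
  -- constant digit after it.
  let g : ℕ × ℕ × ℕ → ℕ → ℕ := fun p n => if n < p.1 then w n else if n = p.1 then p.2.1 else p.2.2
  refine ((countable_singleton w).union (countable_range g)).mono fun β hβ => ?_
  rcases eq_or_deviates hs hsr hw1 hw2 hβ with h | ⟨k, hk, h⟩
  · exact Or.inl h
  · right
    have : ∃ c, ∀ j, k < j → β j = c := by
      rcases h with h | h
      · exact ⟨0, fun j hj => (h.2 j hj).1⟩
      · exact ⟨r, fun j hj => (h.2 j hj).1⟩
    obtain ⟨c, hc⟩ := this
    refine ⟨(k, β k, c), funext fun n => ?_⟩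
    simp only [g]
    split_ifs with h1 h2
    · exact (hk n h1).symm
    · rw [h2]
    · exact (hc n (by omega)).symm

theorem word_le {r k a b c : ℕ} (ha : a ≤ r) (hb : b ≤ r) (hc : c ≤ r) (n : ℕ) :
    word k a b c n ≤ r := by
  unfold word
  split_ifs <;> assumption

/-- After the common prefix and one multiplication by `s`, the two sides of `h` are the values to be
compared. -/
theorem value_word {s k a b c : ℕ} (hs : 1 < s)
    (h : (b : ℝ) + c / ((s : ℝ) - 1) = a + a / ((s : ℝ) - 1)) :
    value s (word k a b c) = value s (const a) := by
  have hd : ∀ n, word k a b c n ≤ max a (max b c) := word_le (by simp) (by simp) (by simp)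
  have hd' : ∀ n, const a n ≤ max a (max b c) := fun n => le_max_left _ _
  rw [value_eq_iff_of_prefix hs hd hd' (N := k) fun i hi => by simp [word, const, hi]]
  have h1 := mul_value hs (α := fun n => word k a b c (n + k)) fun n => hd _
  have h2 := mul_value hs (α := fun n => const a (n + k)) fun n => hd' _
  have h3 : (fun n => word k a b c (n + 1 + k)) = const c := by
    funext n
    simp only [word, const]
    rw [if_neg (by omega), if_neg (by omega)]
  have h4 : (fun n => const a (n + 1 + k)) = const a := rfl
  rw [h3, value_const hs] at h1
  rw [h4, value_const hs] at h2
  have h5 : word k a b c (0 + k) = b := by simp [word]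
  simp only [h5] at h1
  have h6 : const a (0 + k) = a := rfl
  simp only [h6] at h2
  have hs' : (s : ℝ) ≠ 0 := by positivity
  exact mul_left_cancel₀ hs' (by rw [h1, h2, h])

theorem word_injective {a b c : ℕ} (hab : a ≠ b) : Function.Injective fun k => word k a b c := by
  intro k l h
  by_contra hne
  wlog hlt : k < l generalizing k l
  · exact this h.symm (Ne.symm hne) (by omega)
  have := congrFun h k
  simp [word, hlt] at this
  exact hab this.symm

theorem representations_const_max {r s : ℕ} (hs : 1 < s) (hsr : s ≤ r) (hr : r ≤ 2 * s - 2) :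
    representations r s (value s (const (s - 1))) =
      {α | α = const (s - 1) ∨ (∃ k : ℕ, α = word k (s - 1) s 0) ∨
        (r = 2 * s - 2 ∧ ∃ k : ℕ, α = word k (s - 1) (s - 2) r)} := by
  have hs' : (1 : ℝ) < s := by exact_mod_cast hs
  have hs1 : (s : ℝ) - 1 ≠ 0 := by linarith
  ext β
  constructor
  · intro hβ
    rcases eq_or_deviates hs hsr (w := const (s - 1)) (fun n => by simp only [const]; omega)
      (fun n => le_rfl) hβ with h | ⟨k, hk, ⟨h1, h2⟩ | ⟨h1, h2⟩⟩
    · exact Or.inl h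
    · refine Or.inr (Or.inl ⟨k, funext fun n => ?_⟩)
      simp only [word]
      split_ifs with h3 h4
      · exact hk n h3
      · rw [h4, h1]; simp only [const]; omega
      · exact (h2 n (by omega)).1
    · have h0 := (h2 (k + 1) (by omega)).2
      simp only [const] at h0 h1
      refine Or.inr (Or.inr ⟨by omega, k, funext fun n => ?_⟩)
      simp only [word]
      split_ifs with h3 h4
      · exact hk n h3
      · rw [h4]; omega
      · exact (h2 n (by omega)).1
  · rintro (rfl | ⟨k, rfl⟩ | ⟨hr', k, rfl⟩)
    · exact ⟨fun n => by simp only [const]; omega, rfl⟩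
    · refine ⟨word_le (by omega) hsr (by omega), value_word hs ?_⟩
      rw [Nat.cast_sub hs.le]
      field_simp
      push_cast
      ring
    · refine ⟨word_le (by omega) (by omega) le_rfl, value_word hs ?_⟩
      rw [Nat.cast_sub hs.le, hr', Nat.cast_sub (by omega), Nat.cast_sub (by omega)]
      field_simp
      push_cast
      ring

theorem representations_const_min {r s : ℕ} (hs : 1 < s) (hsr : s ≤ r) (hr : r ≤ 2 * s - 2) :
    representations r s (value s (const (r - s + 1))) =
      {α | α = const (r - s + 1) ∨ (∃ k : ℕ, α = word k (r - s + 1) (r - s) r) ∨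
        (r = 2 * s - 2 ∧ ∃ k : ℕ, α = word k (r - s + 1) (r - s + 2) 0)} := by
  have hs' : (1 : ℝ) < s := by exact_mod_cast hs
  have hs1 : (s : ℝ) - 1 ≠ 0 := by linarith
  ext β
  constructor
  · intro hβ
    rcases eq_or_deviates hs hsr (w := const (r - s + 1)) (fun n => le_rfl)
      (fun n => by simp only [const]; omega) hβ with h | ⟨k, hk, ⟨h1, h2⟩ | ⟨h1, h2⟩⟩
    · exact Or.inl h
    · have h0 := (h2 (k + 1) (by omega)).2
      simp only [const] at h0 h1
      refine Or.inr (Or.inr ⟨by omega, k, funext fun n => ?_⟩)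
      simp only [word]
      split_ifs with h3 h4
      · exact hk n h3
      · rw [h4, h1]
      · exact (h2 n (by omega)).1
    · refine Or.inr (Or.inl ⟨k, funext fun n => ?_⟩)
      simp only [const] at h1
      simp only [word]
      split_ifs with h3 h4
      · exact hk n h3
      · rw [h4]; omega
      · exact (h2 n (by omega)).1
  · rintro (rfl | ⟨k, rfl⟩ | ⟨hr', k, rfl⟩)
    · exact ⟨fun n => by simp only [const]; omega, rfl⟩
    · refine ⟨word_le (by omega) (by omega) le_rfl, value_word hs ?_⟩
      rw [Nat.cast_add, Nat.cast_sub hsr]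
      field_simp
      push_cast
      ring
    · refine ⟨word_le (by omega) (by omega) (by omega), value_word hs ?_⟩
      rw [show r - s + 1 = s - 1 by omega, show r - s + 2 = s by omega, Nat.cast_sub hs.le]
      field_simp
      push_cast
      ring

/-! The level sets of `f` in terms of representations. -/

theorem classicalDigits_le (r : ℕ) (x : ℝ) (n : ℕ) : classicalDigits r x n ≤ r := by
  unfold classicalDigits
  split_ifs
  · exact le_rfl
  · exact Nat.lt_succ_iff.1 (Fin.isLt _)

theorem value_const_self {r : ℕ} (hr : 1 ≤ r) : value (r + 1) (const r) = 1 := by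
  have : (r : ℝ) ≠ 0 := by positivity
  rw [value_const (by omega)]
  push_cast
  rw [add_sub_cancel_right, div_self this]

theorem value_classicalDigits {r : ℕ} (hr : 1 ≤ r) {x : ℝ} (hx : x ∈ Icc (0 : ℝ) 1) :
    value (r + 1) (classicalDigits r x) = x := by
  by_cases h1 : x = 1
  · have : classicalDigits r x = const r := by
      funext n
      simp [classicalDigits, const, h1]
    rw [this, value_const_self hr, h1]
  · have : classicalDigits r x = fun n => (Real.digits x (r + 1) n : ℕ) := by
      funext n
      simp [classicalDigits, h1]
    rw [this, value_eq_ofDigits, Real.ofDigits_digits (by omega) ⟨hx.1, lt_of_le_of_ne hx.2 h1⟩]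

/-- The sequences of digits used by `f`. -/
def IsClassical (r : ℕ) (α : ℕ → ℕ) : Prop :=
  α = const r ∨ ∀ N, ∃ n, N ≤ n ∧ α n ≠ r

/-- A tail `(r)` has value `1` in base `r + 1`, so for `x < 1` some `(r + 1) ^ N * x` would equal
its own floor plus one. -/
theorem isClassical_classicalDigits {r : ℕ} (hr : 1 ≤ r) {x : ℝ} (hx : x ∈ Icc (0 : ℝ) 1) :
    IsClassical r (classicalDigits r x) := by
  by_cases h1 : x = 1
  · left
    funext n
    simp [classicalDigits, const, h1]
  right
  by_contra! hN
  obtain ⟨N, hN⟩ := hN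
  have hx' : x ∈ Ico (0 : ℝ) 1 := ⟨hx.1, lt_of_le_of_ne hx.2 h1⟩
  have hb : 1 < r + 1 := by omega
  have hd : ∀ n, N ≤ n → Real.digits x (r + 1) n = Fin.last r := by
    intro n hn
    have := hN n hn
    simp only [classicalDigits, if_neg h1] at this
    exact Fin.ext this
  have e1 := Real.ofDigits_eq_sum_add_ofDigits (Real.digits x (r + 1)) N
  have e2 : Real.ofDigits (fun i => Real.digits x (r + 1) (i + N)) = 1 := by
    simp_rw [fun i => hd (i + N) (by omega)]
    exact Real.ofDigits_const_last_eq_one' (b := r + 1) hb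
  have e3 := Real.ofDigits_digits_sum_eq (b := r + 1) hx' N
  rw [Real.ofDigits_digits hb hx', e2, mul_one] at e1
  have hpos : (0 : ℝ) < ((r + 1 : ℕ) : ℝ) ^ N := by positivity
  have e4 : ((r + 1 : ℕ) : ℝ) ^ N * x = ⌊((r + 1 : ℕ) : ℝ) ^ N * x⌋₊ + 1 := by
    nth_rewrite 1 [e1]
    rw [mul_add, e3, mul_inv_cancel₀ hpos.ne']
  exact (Nat.lt_floor_add_one (((r + 1 : ℕ) : ℝ) ^ N * x)).ne e4

theorem value_mem_Icc {r : ℕ} (hr : 1 ≤ r) {α : ℕ → ℕ} (hα : ∀ n, α n ≤ r) :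
    value (r + 1) α ∈ Icc (0 : ℝ) 1 := by
  refine ⟨value_nonneg _ _, ?_⟩
  rw [← value_const_self hr]
  exact value_mono (c := r) (by omega) (fun _ => le_rfl) hα

theorem f_value_of_isClassical {r s : ℕ} (hr : 1 ≤ r) {α : ℕ → ℕ} (hα : ∀ n, α n ≤ r)
    (h : IsClassical r α) : f r s (value (r + 1) α) = value s α := by
  rcases h with rfl | h
  · rw [value_const_self hr, f_one]
  · exact f_value hr α hα h

theorem classicalDigits_value {r : ℕ} (hr : 1 ≤ r) {α : ℕ → ℕ} (hα : ∀ n, α n ≤ r)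
    (h : IsClassical r α) : classicalDigits r (value (r + 1) α) = α := by
  rcases h with rfl | h
  · funext n
    simp [value_const_self hr, classicalDigits, const]
  · set a : ℕ → Fin (r + 1) := fun n => ⟨α n, by have := hα n; omega⟩ with ha
    have h1 : value (r + 1) α = Real.ofDigits a := value_eq_ofDigits r a
    obtain ⟨n, -, hn⟩ := h 0
    have h2 : Real.ofDigits a ≠ 1 := (ofDigits_lt_one hr a n hn).ne
    funext n
    simp only [classicalDigits, h1, if_neg h2]
    rw [digits_ofDigits hr a h]

theorem levelSet_eq_image {r : ℕ} (hr : 1 ≤ r) (s : ℕ) (y : ℝ) :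
    levelSet r s y = value (r + 1) '' {α | α ∈ representations r s y ∧ IsClassical r α} := by
  ext x
  constructor
  · rintro ⟨hx, hxy⟩
    exact ⟨classicalDigits r x, ⟨⟨classicalDigits_le r x, hxy⟩, isClassical_classicalDigits hr hx⟩,
      value_classicalDigits hr hx⟩
  · rintro ⟨α, ⟨hα, hc⟩, rfl⟩
    exact ⟨value_mem_Icc hr hα.1, (f_value_of_isClassical hr hα.1 hc).trans hα.2⟩

theorem injOn_value {r : ℕ} (hr : 1 ≤ r) (s : ℕ) (y : ℝ) :
    InjOn (value (r + 1)) {α | α ∈ representations r s y ∧ IsClassical r α} := by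
  intro α hα β hβ h
  rw [← classicalDigits_value hr hα.1.1 hα.2, h, classicalDigits_value hr hβ.1.1 hβ.2]

/-! ### Hausdorff dimension of sets with restricted digits -/

/-- The set of all numbers whose digits in base `b` are less than `m`. -/
def digitSet (b m : ℕ) : Set ℝ := value b '' {a | ∀ n, a n < m}

/-- Without the digit `b - 1`, a tail value is at most `1 - 1 / (b - 1)`, so a difference in a digit
cannot be made up by later digits. The gap after scaling is `1 / (b * (b - 1))`, and `b ^ 2` is a
convenient bound for its inverse. -/
theorem separated {b m : ℕ} (hb : 1 < b) (hm : m < b) {x y : ℕ → ℕ} (hx : ∀ n, x n < m)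
    (hy : ∀ n, y n < m) {k : ℕ} (hk : ∀ i < k, x i = y i) (hlt : x k < y k) :
    ((b : ℝ) ^ k)⁻¹ ≤ (b : ℝ) ^ 2 * (value b y - value b x) := by
  have hm0 : 0 < m := (Nat.zero_le _).trans_lt (hx 0)
  have hx' : ∀ n, x n ≤ m - 1 := fun n => Nat.le_sub_one_of_lt (hx n)
  have hy' : ∀ n, y n ≤ m - 1 := fun n => Nat.le_sub_one_of_lt (hy n)
  have hb' : (1 : ℝ) < b := by exact_mod_cast hb
  have hb1 : (0 : ℝ) < (b : ℝ) - 1 := by linarith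
  have hmb : (m : ℝ) + 1 ≤ b := by exact_mod_cast hm
  have e1 := value_eq_sum_add hb hx' k
  have e2 := value_eq_sum_add hb hy' k
  rw [Finset.sum_congr rfl fun i hi => by rw [hk i (Finset.mem_range.1 hi)]] at e1
  have m1 := mul_value hb (α := fun n => x (n + k)) fun n => hx' _
  have m2 := mul_value hb (α := fun n => y (n + k)) fun n => hy' _
  simp only [zero_add] at m1 m2
  have u := value_le hb (α := fun n => x (n + 1 + k)) fun n => hx' _
  have v := value_nonneg b fun n => y (n + 1 + k)
  have hd : (x k : ℝ) + 1 ≤ y k := by exact_mod_cast hlt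
  have hc : ((m - 1 : ℕ) : ℝ) / ((b : ℝ) - 1) ≤ 1 - 1 / ((b : ℝ) - 1) := by
    rw [le_sub_iff_add_le, ← add_div, div_le_one hb1, Nat.cast_sub hm0]
    push_cast
    linarith
  have h1 : 1 / ((b : ℝ) - 1) ≤
      b * (value b (fun n => y (n + k)) - value b fun n => x (n + k)) := by linarith
  have h2 : 1 ≤ (b : ℝ) ^ 2 * (value b (fun n => y (n + k)) - value b fun n => x (n + k)) := by
    rw [div_le_iff₀ hb1] at h1
    nlinarith
  have h3 : value b y - value b x =
      (value b (fun n => y (n + k)) - value b fun n => x (n + k)) / (b : ℝ) ^ k := by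
    rw [e1, e2]
    ring
  rw [h3, mul_div_assoc', ← one_div]
  gcongr

theorem exists_first_difference {x y : ℕ → ℕ} (h : x ≠ y) :
    ∃ k, (∀ i < k, x i = y i) ∧ x k ≠ y k := by
  classical
  have hex := Function.ne_iff.1 h
  exact ⟨Nat.find hex, fun i hi => not_not.1 (Nat.find_min hex hi), Nat.find_spec hex⟩

theorem exists_separated {b m : ℕ} (hb : 1 < b) (hm : m < b) {x y : ℕ → ℕ} (hx : ∀ n, x n < m)
    (hy : ∀ n, y n < m) (h : x ≠ y) :
    ∃ k, (∀ i < k, x i = y i) ∧ ((b : ℝ) ^ k)⁻¹ ≤ (b : ℝ) ^ 2 * |value b x - value b y| := by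
  obtain ⟨k, hk, hne⟩ := exists_first_difference h
  refine ⟨k, hk, ?_⟩
  rcases lt_or_gt_of_ne hne with h | h
  · rw [abs_sub_comm]
    exact (separated hb hm hx hy hk h).trans (by gcongr; exact le_abs_self _)
  · exact (separated hb hm hy hx (fun i hi => (hk i hi).symm) h).trans
      (by gcongr; exact le_abs_self _)

theorem abs_value_sub_le {b : ℕ} (hb : 1 < b) {x y : ℕ → ℕ} (hx : ∀ n, x n < b)
    (hy : ∀ n, y n < b) {k : ℕ} (hk : ∀ i < k, x i = y i) :
    |value b x - value b y| ≤ ((b : ℝ) ^ k)⁻¹ := by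
  obtain ⟨c, rfl⟩ : ∃ c, b = c + 1 := ⟨b - 1, by omega⟩
  have := Real.abs_ofDigits_sub_ofDigits_le (x := fun n => (⟨x n, hx n⟩ : Fin (c + 1)))
    (y := fun n => (⟨y n, hy n⟩ : Fin (c + 1))) (n := k) fun i hi => Fin.ext (hk i hi)
  rwa [← value_eq_ofDigits, ← value_eq_ofDigits] at this

theorem injOn_value_digits {b m : ℕ} (hb : 1 < b) (hm : m < b) :
    InjOn (value b) {a | ∀ n, a n < m} := by
  intro x hx y hy h
  by_contra hne
  obtain ⟨k, -, hk⟩ := exists_separated hb hm hx hy hne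
  rw [h, sub_self, abs_zero, mul_zero] at hk
  have : (0 : ℝ) < ((b : ℝ) ^ k)⁻¹ := by positivity
  linarith

theorem rpow_log_div_log {b m : ℕ} (hb : 1 < b) (hm : 0 < m) :
    (b : ℝ) ^ (Real.log m / Real.log b) = m := by
  have hb' : (1 : ℝ) < b := by exact_mod_cast hb
  have := Real.log_pos hb'
  rw [Real.rpow_def_of_pos (by positivity), mul_div_cancel₀ _ this.ne',
    Real.exp_log (by exact_mod_cast hm)]

theorem inv_pow_rpow_log_div_log {b m : ℕ} (hb : 1 < b) (hm : 0 < m) (k : ℕ) :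
    (((b : ℝ) ^ k)⁻¹) ^ (Real.log m / Real.log b) = ((m : ℝ) ^ k)⁻¹ := by
  rw [Real.inv_rpow (by positivity), ← Real.rpow_natCast, ← Real.rpow_mul (by positivity),
    mul_comm, Real.rpow_mul (by positivity), rpow_log_div_log hb hm, Real.rpow_natCast]

/-- Rereading the digits in base `m` maps the set onto a superset of `[0, 1]`. By the separation of
distinct sequences this map is Hölder with exponent `log m / log b`, since `b ^ (log m / log b) =
m`. -/
theorem le_dimH_digitSet {b m : ℕ} (hm2 : 2 ≤ m) (hm : m < b) :
    ENNReal.ofReal (Real.log m / Real.log b) ≤ dimH (digitSet b m) := by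
  have hb : 1 < b := by omega
  have hb' : (1 : ℝ) < b := by exact_mod_cast hb
  have hm' : (1 : ℝ) < m := by exact_mod_cast hm2
  set h : ℝ := Real.log m / Real.log b with hh
  have hpos : 0 < h := div_pos (Real.log_pos hm') (Real.log_pos hb')
  set S : Set (ℕ → ℕ) := {a | ∀ n, a n < m} with hS
  have hinj : InjOn (value b) S := injOn_value_digits hb hm
  set g : ℝ → ℝ := fun x => value m (Function.invFunOn (value b) S x) with hg
  have hgv : ∀ a ∈ S, g (value b a) = value m a := fun a ha => by
    simp only [hg, hinj.leftInvOn_invFunOn ha]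
  have holder : HolderOnWith (Real.toNNReal (((b : ℝ) ^ 2) ^ h)) (Real.toNNReal h) g
      (digitSet b m) := by
    rintro _ ⟨x, hx, rfl⟩ _ ⟨y, hy, rfl⟩
    rw [hgv x hx, hgv y hy]
    have key : |value m x - value m y| ≤ ((b : ℝ) ^ 2) ^ h * |value b x - value b y| ^ h := by
      by_cases hxy : x = y
      · rw [hxy, sub_self, abs_zero]; positivity
      obtain ⟨k, hk, hsep⟩ := exists_separated hb hm hx hy hxy
      refine (abs_value_sub_le (by omega) hx hy hk).trans ?_
      rw [← Real.mul_rpow (by positivity) (by positivity)]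
      refine le_trans (le_of_eq ?_) (Real.rpow_le_rpow (by positivity) hsep hpos.le)
      rw [inv_pow_rpow_log_div_log hb (by omega)]
    rw [edist_dist, edist_dist, Real.dist_eq, Real.dist_eq, Real.coe_toNNReal _ hpos.le,
      ENNReal.ofReal_rpow_of_nonneg (abs_nonneg _) hpos.le]
    change _ ≤ ENNReal.ofReal _ * _
    rw [← ENNReal.ofReal_mul (by positivity)]
    exact ENNReal.ofReal_le_ofReal key
  have himg : Icc (0 : ℝ) 1 ⊆ g '' digitSet b m := by
    intro y hy
    obtain ⟨d, -, rfl⟩ := Real.ofDigits_SurjOn (b := m) (by omega) hy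
    obtain ⟨c, rfl⟩ : ∃ c, m = c + 1 := ⟨m - 1, by omega⟩
    have hd : (fun n => (d n : ℕ)) ∈ S := fun n => (d n).isLt
    exact ⟨_, ⟨_, hd, rfl⟩, by rw [hgv _ hd, value_eq_ofDigits]⟩
  have h1 : (1 : ENNReal) ≤ dimH (digitSet b m) / (Real.toNNReal h : NNReal) := by
    refine le_trans ?_ (holder.dimH_image_le (Real.toNNReal_pos.2 hpos))
    refine le_trans (le_of_eq ?_) (dimH_mono himg)
    rw [Real.dimH_of_nonempty_interior]
    · simp
    · rw [interior_Icc]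
      exact ⟨1 / 2, by norm_num, by norm_num⟩
  have h2 := (ENNReal.le_div_iff_mul_le (Or.inl ?_) (Or.inl ENNReal.coe_ne_top)).1 h1
  · rwa [one_mul] at h2
  · exact ENNReal.coe_ne_zero.2 (Real.toNNReal_pos.2 hpos).ne'

/-- The `m ^ n` cylinders of length `n` have diameter at most `b ^ (-n)`; with exponent `log m / log
b` the covering sums are at most `1`. -/
theorem dimH_digitSet_le {b m : ℕ} (hm1 : 1 ≤ m) (hm : m < b) :
    dimH (digitSet b m) ≤ ENNReal.ofReal (Real.log m / Real.log b) := by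
  have hb : 1 < b := by omega
  have hb' : (1 : ℝ) < b := by exact_mod_cast hb
  have hm' : (1 : ℝ) ≤ m := by exact_mod_cast hm1
  set h : ℝ := Real.log m / Real.log b with hh
  have hpos : 0 ≤ h := div_nonneg (Real.log_nonneg hm') (Real.log_nonneg hb'.le)
  borelize ℝ
  refine dimH_le_of_hausdorffMeasure_ne_top (d := Real.toNNReal h) ?_
  rw [Real.coe_toNNReal _ hpos]
  have hlim : Filter.Tendsto (fun n : ℕ => ENNReal.ofReal (((b : ℝ) ^ n)⁻¹)) Filter.atTop
      (nhds 0) := by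
    rw [← ENNReal.ofReal_zero]
    refine ENNReal.tendsto_ofReal ?_
    simp_rw [← inv_pow]
    exact tendsto_pow_atTop_nhds_zero_of_lt_one (by positivity) (inv_lt_one_of_one_lt₀ hb')
  let t : ∀ n : ℕ, (Fin n → Fin m) → Set ℝ := fun n p =>
    value b '' {a | (∀ i, a i < m) ∧ ∀ i : Fin n, a i = p i}
  have ht : ∀ n p, Metric.ediam (t n p) ≤ ENNReal.ofReal (((b : ℝ) ^ n)⁻¹) := by
    intro n p
    refine Metric.ediam_le ?_
    rintro _ ⟨x, ⟨hx, hxp⟩, rfl⟩ _ ⟨y, ⟨hy, hyp⟩, rfl⟩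
    rw [edist_dist, Real.dist_eq]
    exact ENNReal.ofReal_le_ofReal (abs_value_sub_le hb (fun i => (hx i).trans hm)
      (fun i => (hy i).trans hm) fun i hi => (hxp ⟨i, hi⟩).trans (hyp ⟨i, hi⟩).symm)
  have hcov : ∀ n, digitSet b m ⊆ ⋃ p, t n p := by
    rintro n _ ⟨x, hx, rfl⟩
    exact mem_iUnion.2 ⟨fun i => ⟨x i, hx i⟩, x, ⟨hx, fun i => rfl⟩, rfl⟩
  have hle := MeasureTheory.Measure.hausdorffMeasure_le_liminf_sum h (digitSet b m) _ hlim t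
    (Filter.Eventually.of_forall ht) (Filter.Eventually.of_forall hcov)
  refine ne_top_of_le_ne_top ENNReal.one_ne_top (hle.trans ?_)
  refine Filter.liminf_le_of_le (by isBoundedDefault) fun c hc => ?_
  obtain ⟨n, hn⟩ := hc.exists
  refine hn.trans ?_
  calc ∑ p, Metric.ediam (t n p) ^ h
      ≤ ∑ _p : Fin n → Fin m, ENNReal.ofReal (((b : ℝ) ^ n)⁻¹) ^ h :=
        Finset.sum_le_sum fun p _ => ENNReal.rpow_le_rpow (ht n p) hpos
    _ = 1 := by
        rw [ENNReal.ofReal_rpow_of_nonneg (by positivity) hpos,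
          inv_pow_rpow_log_div_log hb (by omega), Finset.sum_const, Finset.card_univ, Fintype.card_fun,
          Fintype.card_fin, Fintype.card_fin, nsmul_eq_mul,
          ← ENNReal.ofReal_natCast, ← ENNReal.ofReal_mul (by positivity)]
        push_cast
        rw [mul_inv_cancel₀ (by positivity), ENNReal.ofReal_one]

theorem dimH_digitSet {b m : ℕ} (hm1 : 1 ≤ m) (hm : m < b) :
    dimH (digitSet b m) = ENNReal.ofReal (Real.log m / Real.log b) := by
  refine le_antisymm (dimH_digitSet_le hm1 hm) ?_
  rcases hm1.eq_or_lt with rfl | h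
  · simp
  · exact le_dimH_digitSet h hm

theorem antilipschitz_affine (k : ℝ) {d : ℝ} (hd : 0 < d) :
    AntilipschitzWith (Real.toNNReal d⁻¹) fun x : ℝ => k + d * x := by
  refine AntilipschitzWith.of_le_mul_dist fun x y => ?_
  rw [Real.coe_toNNReal _ (by positivity), Real.dist_eq, Real.dist_eq, add_sub_add_left_eq_sub,
    ← mul_sub, abs_mul, abs_of_pos hd, inv_mul_cancel_left₀ hd.ne']

theorem lipschitz_affine (k d : ℝ) :
    LipschitzWith (Real.toNNReal |d|) fun x : ℝ => k + d * x := by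
  refine LipschitzWith.of_dist_le_mul fun x y => ?_
  rw [Real.coe_toNNReal _ (abs_nonneg _), Real.dist_eq, Real.dist_eq, add_sub_add_left_eq_sub,
    ← mul_sub, abs_mul]

/-! ### Existence and uniqueness of representations -/

theorem exists_value_eq {r s : ℕ} (hs : 1 < s) (hsr : s ≤ r) (hr : r ≤ 2 * s - 2) {y : ℝ}
    (h0 : 0 ≤ y) (h1 : y ≤ r / ((s : ℝ) - 1)) : ∃ α : ℕ → ℕ, (∀ n, α n ≤ r) ∧ value s α = y := by
  have hs' : (1 : ℝ) < s := by exact_mod_cast hs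
  have unit : ∀ z ∈ Icc (0 : ℝ) 1, ∃ α : ℕ → ℕ, (∀ n, α n ≤ r) ∧ value s α = z := by
    intro z hz
    obtain ⟨c, rfl⟩ : ∃ c, s = c + 1 := ⟨s - 1, by omega⟩
    obtain ⟨d, -, rfl⟩ := Real.ofDigits_SurjOn hs hz
    exact ⟨fun n => d n, fun n => by have := (d n).isLt; dsimp only; omega, value_eq_ofDigits c d⟩
  by_cases hy : y ≤ 1
  · exact unit y ⟨h0, hy⟩
  have hr' : (r : ℝ) + 2 ≤ 2 * s := by exact_mod_cast (by omega : r + 2 ≤ 2 * s)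
  have hM : (r : ℝ) / ((s : ℝ) - 1) ≤ 2 := by
    rw [div_le_iff₀ (by linarith)]
    linarith
  -- For `y > 1` the reflected number `M - y` is below `1` because `M ≤ 2`; reflecting its digits by
  -- `e ↦ r - e` gives those of `y`.
  obtain ⟨e, he, hv⟩ := unit (r / ((s : ℝ) - 1) - y) ⟨by linarith, by linarith⟩
  refine ⟨fun n => r - e n, fun n => Nat.sub_le _ _, ?_⟩
  have h := value_add hs (α := fun n => r - e n) (fun n => Nat.sub_le _ _) he
  have h2 : (fun n => r - e n + e n) = const r := funext fun n => Nat.sub_add_cancel (he n)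
  rw [h2, value_const hs] at h
  linarith

/-- The sequence `γ` is the only representation of its value. -/
def IsUniqueRepresentation (r s : ℕ) (γ : ℕ → ℕ) : Prop :=
  ∀ β ∈ representations r s (value s γ), β = γ

theorem isClosed_representations (r : ℕ) {s : ℕ} (hs : 1 < s) (y : ℝ) :
    IsClosed (representations r s y) := by
  have hc : IsClosed {α : ℕ → ℕ | ∀ n, α n ≤ r} := by
    simp only [ofPred_forall]
    exact isClosed_iInter fun n => isClosed_le (continuous_apply n) continuous_const
  exact (continuousOn_value hs r).preimage_isClosed_of_isClosed hc isClosed_singleton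

/-- A number with countably many representations has one with a tail that is the only
representation of its value. -/
theorem exists_isUniqueRepresentation_tail {r s : ℕ} (hs : 1 < s) {y : ℝ}
    (hne : (representations r s y).Nonempty) (hc : (representations r s y).Countable) :
    ∃ α ∈ representations r s y, ∃ N, IsUniqueRepresentation r s fun n => α (n + N) := by
  by_contra! H
  have hperf : Perfect (representations r s y) := by
    refine ⟨isClosed_representations r hs y, fun α hα => ?_⟩
    rw [accPt_iff_frequently]
    have hβ : ∀ N, ∃ β, (∀ n, β n ≤ r) ∧ value s β = value s (fun n => α (n + N)) ∧
        β ≠ fun n => α (n + N) := by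
      intro N
      have := H α hα N
      simp only [IsUniqueRepresentation, not_forall] at this
      obtain ⟨β, h1, h2⟩ := this
      exact ⟨β, h1.1, h1.2, h2⟩
    choose β hβr hβv hβn using hβ
    -- Exchanging the tail from place `N` on for another representation of its value gives points of
    -- the set that differ from `α` and converge to it.
    set γ : ℕ → ℕ → ℕ := fun N n => if n < N then α n else β N (n - N) with hγ
    have hshift : ∀ N, (fun n => γ N (n + N)) = β N := fun N => funext fun n => by simp [hγ]
    have hγr : ∀ N n, γ N n ≤ r := fun N n => by
      simp only [hγ]
      split_ifs
      · exact hα.1 n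
      · exact hβr N _
    have hmem : ∀ N, γ N ∈ representations r s y := fun N => by
      refine ⟨hγr N, ?_⟩
      rw [← hα.2, value_eq_iff_of_prefix hs (hγr N) hα.1 (N := N) fun i hi => by simp [hγ, hi],
        hshift, hβv]
    have hneq : ∀ N, γ N ≠ α := fun N h => by
      apply hβn N
      rw [← hshift N, h]
    have hlim : Filter.Tendsto γ Filter.atTop (nhds α) := by
      rw [tendsto_pi_nhds]
      intro n
      refine tendsto_const_nhds.congr' ?_
      filter_upwards [Filter.eventually_gt_atTop n] with N hN
      simp [hγ, hN]
    exact hlim.frequently (Filter.Frequently.of_forall fun N => ⟨hneq N, hmem N⟩)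
  -- A nonempty perfect set in this Polish space contains an injective image of Cantor space, so it
  -- is not countable.
  have h5 : Cardinal.mk (ℕ → Bool) = Cardinal.continuum := by simp
  let := TopologicalSpace.upgradeIsCompletelyMetrizable (ℕ → ℕ)
  obtain ⟨g, hg, -, hinj⟩ := hperf.exists_nat_bool_injection hne
  have h1 : (range g).Countable := hc.mono hg
  rw [← image_univ] at h1
  have h2 := countable_of_injective_of_countable_image hinj.injOn h1
  have h3 := Set.countable_univ_iff.1 h2
  have h4 : Cardinal.mk (ℕ → Bool) ≤ Cardinal.aleph0 := Cardinal.mk_le_aleph0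
  rw [h5] at h4
  exact absurd Cardinal.aleph0_lt_continuum h4.not_gt

theorem IsUniqueRepresentation.tail {r s : ℕ} (hs : 1 < s) {γ : ℕ → ℕ} (hγ : ∀ n, γ n ≤ r)
    (h : IsUniqueRepresentation r s γ) (N : ℕ) :
    IsUniqueRepresentation r s fun n => γ (n + N) := by
  rintro β ⟨hβ, hv⟩
  set δ : ℕ → ℕ := fun n => if n < N then γ n else β (n - N) with hδ
  have hshift : (fun n => δ (n + N)) = β := funext fun n => by simp [hδ]
  have hδr : ∀ n, δ n ≤ r := fun n => by
    simp only [hδ]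
    split_ifs
    · exact hγ n
    · exact hβ _
  have : δ = γ := by
    refine h δ ⟨hδr, ?_⟩
    rw [value_eq_iff_of_prefix hs hδr hγ (N := N) fun i hi => by simp [hδ, hi], hshift, hv]
  rw [← hshift, this]

/-- Any digit whose remainder lies in `[0, M]` can be continued to a representation, so uniqueness
leaves only one such digit. -/
theorem IsUniqueRepresentation.first_digit {r s : ℕ} (hs : 1 < s) (hsr : s ≤ r)
    (hr : r ≤ 2 * s - 2) {γ : ℕ → ℕ} (h : IsUniqueRepresentation r s γ)
    {d : ℕ} (hd : d ≤ r) (h0 : 0 ≤ s * value s γ - d)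
    (h1 : s * value s γ - d ≤ r / ((s : ℝ) - 1)) : γ 0 = d := by
  obtain ⟨β, hβ, hv⟩ := exists_value_eq hs hsr hr h0 h1
  set δ : ℕ → ℕ := fun n => if n = 0 then d else β (n - 1) with hδ
  have hδr : ∀ n, δ n ≤ r := fun n => by
    simp only [hδ]
    split_ifs
    · exact hd
    · exact hβ _
  have hshift : (fun n => δ (n + 1)) = β := funext fun n => by simp [hδ]
  have h2 := mul_value hs hδr
  have h3 : δ 0 = d := by simp [hδ]
  rw [hshift, hv, h3, add_sub_cancel] at h2
  have hs' : (s : ℝ) ≠ 0 := by positivity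
  rw [← h δ ⟨hδr, mul_left_cancel₀ hs' h2⟩, h3]

/-- A unique representation is `(0)` or `(r)`, or its digits are eventually between `r - s + 1`
and `s - 1`. -/
theorem IsUniqueRepresentation.cases {r s : ℕ} (hs : 1 < s) (hsr : s ≤ r)
    (hr : r ≤ 2 * s - 2) {γ : ℕ → ℕ} (hγ : ∀ n, γ n ≤ r) (h : IsUniqueRepresentation r s γ) :
    (∀ n, γ n = 0) ∨ (∀ n, γ n = r) ∨ ∃ N, ∀ n, r - s + 1 ≤ γ (n + N) ∧ γ (n + N) ≤ s - 1 := by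
  have hs' : (1 : ℝ) < s := by exact_mod_cast hs
  have hsr' : (s : ℝ) ≤ r := by exact_mod_cast hsr
  have hr' : (r : ℝ) + 2 ≤ 2 * s := by exact_mod_cast (by omega : r + 2 ≤ 2 * s)
  set M : ℝ := r / ((s : ℝ) - 1) with hM
  have hsM : s * M = r + M := by
    have : (s : ℝ) - 1 ≠ 0 := by linarith
    rw [hM]
    field_simp
    ring
  have hM1 : 1 < M := by
    rw [hM, lt_div_iff₀ (by linarith)]
    linarith
  have hM2 : M ≤ 2 := by
    rw [hM, div_le_iff₀ (by linarith)]
    linarith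
  set T : ℕ → ℝ := fun n => value s fun i => γ (i + n) with hT
  have hT0 : ∀ n, 0 ≤ T n := fun n => value_nonneg _ _
  have hTM : ∀ n, T n ≤ M := fun n => value_le hs fun i => hγ _
  have step : ∀ n, s * T n = γ n + T (n + 1) := by
    intro n
    have := mul_value hs (α := fun i => γ (i + n)) fun i => hγ _
    simp only [zero_add, add_right_comm _ 1 n] at this
    exact this
  have digit : ∀ n d : ℕ, d ≤ r → 0 ≤ s * T n - d → s * T n - d ≤ M → γ n = d := by
    intro n d hd h0 h1
    have := (h.tail hs hγ n).first_digit hs hsr hr hd h0 h1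
    simpa using this
  -- If the following tail is at least `1`, the digit could be raised by one, unless it is already
  -- `r`; `low` is the mirror image.
  have high : ∀ n, 1 ≤ T (n + 1) → γ n = r := by
    intro n hn
    by_contra hne
    have hlt : γ n < r := lt_of_le_of_ne (hγ n) hne
    have := digit n (γ n + 1) hlt (by rw [step]; push_cast; linarith)
      (by rw [step]; push_cast; linarith [hTM (n + 1)])
    omega
  have low : ∀ n, T (n + 1) ≤ M - 1 → γ n = 0 := by
    intro n hn
    by_contra hne
    have hc : ((γ n - 1 : ℕ) : ℝ) = γ n - 1 := by
      rw [Nat.cast_sub (Nat.one_le_iff_ne_zero.2 hne)]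
      simp
    have := digit n (γ n - 1) ((Nat.sub_le _ _).trans (hγ n))
      (by rw [step, hc]; linarith [hT0 (n + 1)]) (by rw [step, hc]; linarith)
    omega
  by_cases hmid : ∃ N, M - 1 < T N ∧ T N < 1
  · obtain ⟨N, hN⟩ := hmid
    -- The open interval `(M - 1, 1)` is never left: outside it the digit is forced to be `0` or
    -- `r`, which contradicts `s * T n` lying between `s * (M - 1)` and `s`.
    have next : ∀ n, M - 1 < T n ∧ T n < 1 → M - 1 < T (n + 1) ∧ T (n + 1) < 1 := by
      rintro n ⟨h1, h2⟩
      have e := step n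
      have b1 : s * (M - 1) < s * T n := by gcongr
      have b2 : s * T n < s * 1 := by gcongr
      constructor
      · by_contra! hcon
        rw [low n hcon] at e
        push_cast at e
        linarith
      · by_contra! hcon
        rw [high n hcon] at e
        linarith
    have all : ∀ n, M - 1 < T (n + N) ∧ T (n + N) < 1 := by
      intro n
      induction n with
      | zero => simpa using hN
      | succ n ih =>
        rw [add_right_comm]
        exact next _ ih
    refine Or.inr (Or.inr ⟨N, fun n => ?_⟩)
    have e := step (n + N)
    have b1 : s * (M - 1) < s * T (n + N) := by gcongr; exact (all n).1
    have b2 : s * T (n + N) < s * 1 := by gcongr; exact (all n).2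
    have b3 := next _ (all n)
    have c1 : (r : ℝ) < γ (n + N) + s := by linarith
    have c2 : (γ (n + N) : ℝ) < s := by linarith
    have c1' : r < γ (n + N) + s := by exact_mod_cast c1
    have c2' : γ (n + N) < s := by exact_mod_cast c2
    omega
  -- Now each tail value is at most `M - 1` or at least `1`, and the forced digits keep it on the
  -- side where it starts.
  · push Not at hmid
    rcases le_or_gt (T 0) (M - 1) with h0 | h0
    · left
      have all : ∀ n, T n ≤ M - 1 := by
        intro n
        induction n with
        | zero => exact h0
        | succ n ih =>
          by_contra! hcon
          have e := step n
          rw [high n (hmid _ hcon)] at e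
          have b1 : s * T n ≤ s * (M - 1) := by gcongr
          linarith [hmid _ hcon]
      exact fun n => low n (all _)
    · right; left
      have all : ∀ n, 1 ≤ T n := by
        intro n
        induction n with
        | zero => exact hmid 0 h0
        | succ n ih =>
          refine hmid _ ?_
          by_contra! hcon
          have e := step n
          rw [low n hcon] at e
          have b1 : s * 1 ≤ s * T n := by gcongr
          push_cast at e
          linarith
      exact fun n => high n (all _)

/-! ### Values with finite or countable level sets -/

theorem countable_eventually_eq (r : ℕ) :
    {α : ℕ → ℕ | ∃ N, ∀ n, N ≤ n → α n = r}.Countable := by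
  -- The list holds the initial digits; the default value of `getD` supplies the tail `r`.
  refine (countable_range fun (l : List ℕ) (n : ℕ) => l.getD n r).mono ?_
  rintro α ⟨N, hN⟩
  refine ⟨(List.range N).map α, funext fun n => ?_⟩
  rcases lt_or_ge n N with h | h
  · simp [List.getD, h]
  · rw [hN n h]
    simp [List.getD, h]

theorem countable_representations_of_levelSet {r : ℕ} (hr : 1 ≤ r) {s : ℕ} {y : ℝ}
    (h : (levelSet r s y).Countable) : (representations r s y).Countable := by
  rw [levelSet_eq_image hr] at h
  have h1 := countable_of_injective_of_countable_image (injOn_value hr s y) h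
  refine (h1.union (countable_eventually_eq r)).mono fun α hα => ?_
  by_cases hc : IsClassical r α
  · exact Or.inl ⟨hα, hc⟩
  · right
    simp only [IsClassical, not_or, not_forall, not_exists, not_and, not_not] at hc
    exact hc.2

theorem countable_levelSet_of_representations {r : ℕ} (hr : 1 ≤ r) {s : ℕ} {y : ℝ}
    (h : (representations r s y).Countable) : (levelSet r s y).Countable := by
  rw [levelSet_eq_image hr]
  exact (h.mono fun α hα => hα.1).image _

/-- The numbers with digits between `r - s + 1` and `s - 1` in base `s`. -/
def middleSet (r s : ℕ) : Set ℝ :=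
  value s '' {w | ∀ n, r - s + 1 ≤ w n ∧ w n ≤ s - 1}

/-- Subtracting `r - s + 1` from every digit leaves the digits below `2 * s - 1 - r`. -/
theorem middleSet_eq {r s : ℕ} (hs : 1 < s) (hsr : s ≤ r) :
    middleSet r s =
      (fun x => value s (const (r - s + 1)) + 1 * x) '' digitSet s (2 * s - 1 - r) := by
  ext y
  constructor
  · rintro ⟨w, hw, rfl⟩
    refine ⟨_, ⟨fun n => w n - (r - s + 1), fun n => ?_, rfl⟩, ?_⟩
    · have := hw n
      dsimp only
      omega
    · have h := value_add_mul hs (α := fun n => w n - (r - s + 1)) (c := s)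
        (fun n => by have := hw n; omega) (r - s + 1) 1
      simp only [Nat.cast_one] at h
      simp only
      rw [← h]
      congr 1
      funext n
      have := hw n
      omega
  · rintro ⟨_, ⟨a, ha, rfl⟩, rfl⟩
    have h := value_add_mul hs (α := a) (c := 2 * s - 1 - r) (fun n => (ha n).le) (r - s + 1) 1
    rw [Nat.cast_one] at h
    refine ⟨_, fun n => ?_, h⟩
    have := ha n
    omega

theorem dimH_middleSet {r s : ℕ} (hs : 1 < s) (hsr : s ≤ r) (hr : r ≤ 2 * s - 2) :
    dimH (middleSet r s) = ENNReal.ofReal (Real.log (2 * (s : ℝ) - r - 1) / Real.log s) := by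
  have h1 : ((2 * s - 1 - r : ℕ) : ℝ) = 2 * (s : ℝ) - r - 1 := by
    rw [Nat.cast_sub (by omega), Nat.cast_sub (by omega)]
    push_cast
    ring
  rw [← h1, ← dimH_digitSet (by omega) (by omega), middleSet_eq hs hsr]
  exact le_antisymm ((lipschitz_affine _ _).dimH_image_le _)
    ((antilipschitz_affine _ one_pos).le_dimH_image _)

theorem dimH_countable_levelSet {r s : ℕ} (hs : 1 < s) (hsr : s ≤ r) (hr : r ≤ 2 * s - 2) :
    dimH {y : ℝ | y ∈ f r s '' Icc (0 : ℝ) 1 ∧ (levelSet r s y).Countable} =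
      ENNReal.ofReal (Real.log (2 * (s : ℝ) - r - 1) / Real.log s) := by
  have hr1 : 1 ≤ r := by omega
  rw [← dimH_middleSet hs hsr hr]
  apply le_antisymm
  -- The two added points are the values of the unique tails `(0)` and `(r)`; a finite set does not
  -- change the dimension.
  · set E : Set ℝ := middleSet r s ∪ {0, (r : ℝ) / ((s : ℝ) - 1)} with hE
    have hdE : dimH E = dimH (middleSet r s) := by
      rw [hE, dimH_union, dimH_finite (s := {0, (r : ℝ) / ((s : ℝ) - 1)}) (toFinite _)]
      simp
    have hsub : {y : ℝ | y ∈ f r s '' Icc (0 : ℝ) 1 ∧ (levelSet r s y).Countable} ⊆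
        ⋃ p : ℕ × ℕ, (fun x : ℝ => p.1 / (s : ℝ) ^ p.2 + ((s : ℝ) ^ p.2)⁻¹ * x) '' E := by
      rintro _ ⟨⟨x, hx, rfl⟩, hc⟩
      obtain ⟨α, hα, N, hN⟩ := exists_isUniqueRepresentation_tail (r := r) hs
        ⟨classicalDigits r x, classicalDigits_le r x, rfl⟩
        (countable_representations_of_levelSet hr1 hc)
      have hcov : ∀ L, value s (fun n => α (n + L)) ∈ E →
          f r s x ∈ ⋃ p : ℕ × ℕ, (fun x : ℝ => p.1 / (s : ℝ) ^ p.2 + ((s : ℝ) ^ p.2)⁻¹ * x) '' E := by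
        intro L hL
        obtain ⟨K, hK⟩ := exists_pow_mul_value hs hα.1 L
        refine mem_iUnion.2 ⟨(K, L), _, hL, ?_⟩
        have : (s : ℝ) ^ L ≠ 0 := by positivity
        rw [show f r s x = value s α from hα.2.symm]
        field_simp
        linarith
      rcases hN.cases hs hsr hr fun n => hα.1 _ with h | h | ⟨L, h⟩
      · refine hcov N (Or.inr (Or.inl ?_))
        have : (fun n => α (n + N)) = const 0 := funext h
        rw [this, value_const hs]
        simp
      · refine hcov N (Or.inr (Or.inr ?_))
        have : (fun n => α (n + N)) = const r := funext h
        rw [this, value_const hs]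
        rfl
      · refine hcov (L + N) (Or.inl ⟨_, fun n => ?_, rfl⟩)
        simpa only [add_assoc] using h n
    refine (dimH_mono hsub).trans ?_
    rw [dimH_iUnion, ← hdE]
    exact iSup_le fun p => (lipschitz_affine _ _).dimH_image_le _
  · refine dimH_mono ?_
    rintro _ ⟨w, hw, rfl⟩
    have hwr : ∀ n, w n ≤ r := fun n => by have := hw n; omega
    refine ⟨⟨value (r + 1) w, value_mem_Icc hr1 hwr, ?_⟩, ?_⟩
    · refine f_value hr1 w hwr fun N => ⟨N, le_rfl, ?_⟩
      have := hw N
      omega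
    · exact countable_levelSet_of_representations hr1
        (countable_representations hs hsr (fun n => (hw n).1) fun n => (hw n).2)

/-! Replacing `0 s` by `1 0` does not change a number in base `s`. -/

/-- The sequence that has `1 0` in place of `1` and `0 s` in place of `0`. -/
def blocks (s : ℕ) (a : ℕ → ℕ) : ℕ → ℕ :=
  fun n => if n % 2 = 0 then a (n / 2) else s * (1 - a (n / 2))

theorem blocks_even (s : ℕ) (a : ℕ → ℕ) (n : ℕ) : blocks s a (2 * n) = a n := by
  simp [blocks]

theorem blocks_odd (s : ℕ) (a : ℕ → ℕ) (n : ℕ) : blocks s a (2 * n + 1) = s * (1 - a n) := by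
  have h1 : (2 * n + 1) % 2 ≠ 0 := by omega
  have h2 : (2 * n + 1) / 2 = n := by omega
  rw [blocks, if_neg h1, h2]

theorem blocks_le {s : ℕ} (hs : 1 < s) {a : ℕ → ℕ} (ha : ∀ n, a n < 2) (n : ℕ) :
    blocks s a n ≤ s := by
  have := ha (n / 2)
  unfold blocks
  split_ifs
  · omega
  · exact (Nat.mul_le_mul_left s (Nat.sub_le 1 _)).trans (by omega)

/-- Both `1 0` and `0 s` become the single digit `s` in base `s ^ 2`, whatever the choice `a`. -/
theorem value_blocks {s : ℕ} (hs : 1 < s) {a : ℕ → ℕ} (ha : ∀ n, a n < 2) :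
    value s (blocks s a) = value (s ^ 2) (const s) := by
  rw [value_eq_value_sq hs (blocks_le hs ha)]
  congr 1
  funext n
  have := ha n
  rw [blocks_even, blocks_odd, ← Nat.mul_add, Nat.add_sub_cancel' (by omega), mul_one, const]

/-- In base `b ^ 2` the blocks are the digits `b` and `s`, so the choice `a` stays visible with
weight `b - s`. For `b = r + 1` this embeds an affine Cantor set in a single level set. -/
theorem value_blocks_of_lt {b s : ℕ} (hs : 1 < s) (hb : s < b) {a : ℕ → ℕ} (ha : ∀ n, a n < 2) :
    value b (blocks s a) =
      value (b ^ 2) (const s) + ((b - s : ℕ) : ℝ) * value (b ^ 2) a := by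
  have hb2 : 1 < b ^ 2 := Nat.one_lt_pow (by omega) (by omega)
  rw [value_eq_value_sq (by omega) (blocks_le hs ha),
    ← value_add_mul hb2 (fun n => (ha n).le) s (b - s)]
  congr 1
  funext n
  have h : a n = 0 ∨ a n = 1 := by have := ha n; omega
  rw [blocks_even, blocks_odd]
  rcases h with h | h <;> rw [h] <;> simp
  omega

theorem isClassical_blocks {r s : ℕ} (hr : r ≠ 0) {a : ℕ → ℕ}
    (ha : ∀ n, a n < 2) : IsClassical r (blocks s a) := by
  right
  intro N
  have h : a N = 0 ∨ a N = 1 := by have := ha N; omega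
  rcases h with h | h
  · exact ⟨2 * N, by omega, by rw [blocks_even, h]; exact hr.symm⟩
  · exact ⟨2 * N + 1, by omega, by rw [blocks_odd, h]; simpa using hr.symm⟩

theorem image_digitSet_subset_levelSet {r s : ℕ} (hs : 1 < s) (hsr : s ≤ r) :
    (fun x => value ((r + 1) ^ 2) (const s) + ((r + 1 - s : ℕ) : ℝ) * x) ''
      digitSet ((r + 1) ^ 2) 2 ⊆ levelSet r s (value (s ^ 2) (const s)) := by
  rintro _ ⟨_, ⟨a, ha, rfl⟩, rfl⟩
  simp only
  rw [levelSet_eq_image (by omega), ← value_blocks_of_lt hs (by omega) ha]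
  exact ⟨_, ⟨⟨fun n => (blocks_le hs ha n).trans hsr, value_blocks hs ha⟩,
    isClassical_blocks (by omega) ha⟩, rfl⟩

theorem two_lt_sq {r s : ℕ} (hs : 1 < s) (hsr : s ≤ r) : 2 < (r + 1) ^ 2 := by
  nlinarith

theorem dimH_levelSet_pos {r s : ℕ} (hs : 1 < s) (hsr : s ≤ r) :
    0 < dimH (levelSet r s (value (s ^ 2) (const s))) := by
  have hd : (0 : ℝ) < ((r + 1 - s : ℕ) : ℝ) := by exact_mod_cast (by omega : 0 < r + 1 - s)
  refine lt_of_lt_of_le ?_ (dimH_mono (image_digitSet_subset_levelSet hs hsr))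
  refine lt_of_lt_of_le ?_ ((antilipschitz_affine _ hd).le_dimH_image _)
  rw [dimH_digitSet (by omega) (two_lt_sq hs hsr), ENNReal.ofReal_pos]
  refine div_pos (Real.log_pos (by norm_num)) (Real.log_pos ?_)
  exact_mod_cast (by have := two_lt_sq hs hsr; omega : 1 < (r + 1) ^ 2)

theorem mk_levelSet_eq_continuum {r s : ℕ} (hs : 1 < s) (hsr : s ≤ r) :
    Cardinal.mk (levelSet r s (value (s ^ 2) (const s))) = Cardinal.continuum := by
  have hd : (0 : ℝ) < ((r + 1 - s : ℕ) : ℝ) := by exact_mod_cast (by omega : 0 < r + 1 - s)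
  have h2 := two_lt_sq hs hsr
  have hc : Cardinal.mk (ℕ → Bool) = Cardinal.continuum := by simp
  refine le_antisymm ((Cardinal.mk_set_le _).trans_eq Cardinal.mk_real) ?_
  rw [← hc]
  set a : (ℕ → Bool) → ℕ → ℕ := fun p n => if p n then 1 else 0 with ha
  have ha2 : ∀ p n, a p n < 2 := fun p n => by simp only [ha]; split_ifs <;> omega
  refine Cardinal.mk_le_of_injective (f := fun p => ⟨_, image_digitSet_subset_levelSet hs hsr
    (mem_image_of_mem _ (mem_image_of_mem _ (ha2 p)))⟩) fun p q hpq => ?_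
  have h3 := (antilipschitz_affine _ hd).injective (congrArg Subtype.val hpq)
  have h4 := injOn_value_digits (by omega) h2 (ha2 p) (ha2 q) h3
  funext n
  have := congrFun h4 n
  simp only [ha] at this
  cases hp : p n <;> cases hq : q n <;> simp_all

/-! ### Countably infinite, singleton and two-point level sets -/

theorem mk_eq_aleph0_of_infinite {X : Type} {A : Set X} (hc : A.Countable) (hi : A.Infinite) :
    Cardinal.mk A = Cardinal.aleph0 := by
  have := hc.to_subtype
  have := hi.to_subtype
  exact Cardinal.mk_eq_aleph0 A

theorem infinite_of_word_mem {A : Set (ℕ → ℕ)} {a b c : ℕ} (hab : a ≠ b)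
    (h : ∀ k, word k a b c ∈ A) : A.Infinite :=
  (infinite_range_of_injective (word_injective (c := c) hab)).mono (range_subset_iff.2 h)

theorem mk_representations_const_max {r s : ℕ} (hs : 1 < s) (hsr : s ≤ r) (hr : r ≤ 2 * s - 2) :
    Cardinal.mk (representations r s (value s (const (s - 1)))) = Cardinal.aleph0 := by
  refine mk_eq_aleph0_of_infinite (countable_representations hs hsr
    (fun n => by simp only [const]; omega) fun n => le_rfl) ?_
  rw [representations_const_max hs hsr hr]
  exact infinite_of_word_mem (by omega) fun k => Or.inr (Or.inl ⟨k, rfl⟩)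

theorem mk_representations_const_min {r s : ℕ} (hs : 1 < s) (hsr : s ≤ r) (hr : r ≤ 2 * s - 2) :
    Cardinal.mk (representations r s (value s (const (r - s + 1)))) = Cardinal.aleph0 := by
  refine mk_eq_aleph0_of_infinite (countable_representations hs hsr
    (fun n => le_rfl) fun n => by simp only [const]; omega) ?_
  rw [representations_const_min hs hsr hr]
  exact infinite_of_word_mem (a := r - s + 1) (b := r - s) (by omega)
    fun k => Or.inr (Or.inl ⟨k, rfl⟩)

theorem mk_levelSet_const_max {r s : ℕ} (hs : 1 < s) (hsr : s ≤ r) (hr : r ≤ 2 * s - 2) :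
    Cardinal.mk (levelSet r s (value s (const (s - 1)))) = Cardinal.aleph0 := by
  have hr1 : 1 ≤ r := by omega
  refine mk_eq_aleph0_of_infinite (countable_levelSet_of_representations hr1
    (countable_representations hs hsr (fun n => by simp only [const]; omega) fun n => le_rfl)) ?_
  rw [levelSet_eq_image hr1]
  refine Infinite.image (injOn_value hr1 _ _) ?_
  -- The family with period `(0)` is used by `f`, as `0 ≠ r`, and already makes the level set
  -- infinite.
  refine infinite_of_word_mem (a := s - 1) (b := s) (c := 0) (by omega) fun k => ⟨?_, ?_⟩
  · rw [representations_const_max hs hsr hr]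
    exact Or.inr (Or.inl ⟨k, rfl⟩)
  · refine Or.inr fun N => ⟨N + k + 1, by omega, ?_⟩
    simp only [word]
    rw [if_neg (by omega), if_neg (by omega)]
    omega

/-- If `r < 2 * s - 2`, only the constant representation of the value of `(r - s + 1)` does not
end in the period `(r)`. -/
theorem eq_const_of_mem_representations {r s : ℕ} (hs : 1 < s) (hsr : s ≤ r)
    (hr : r < 2 * s - 2) {β : ℕ → ℕ} (hβ : β ∈ representations r s (value s (const (r - s + 1))))
    (h : ∀ N, ∃ n, N ≤ n ∧ β n ≠ r) : β = const (r - s + 1) := by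
  rw [representations_const_min hs hsr hr.le] at hβ
  rcases hβ with h1 | ⟨k, rfl⟩ | ⟨h1, -⟩
  · exact h1
  · obtain ⟨n, hn, hne⟩ := h (k + 1)
    simp only [word] at hne
    rw [if_neg (by omega), if_neg (by omega)] at hne
    exact absurd rfl hne
  · omega

theorem levelSet_const_min {r s : ℕ} (hs : 1 < s) (hsr : s ≤ r) (hr : r < 2 * s - 2) :
    levelSet r s (value s (const (r - s + 1))) = {value (r + 1) (const (r - s + 1))} := by
  rw [levelSet_eq_image (by omega), ← image_singleton]
  congr 1
  ext β
  constructor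
  · rintro ⟨h1, rfl | h2⟩
    · have h2 := h1.2
      rw [value_const hs, value_const hs] at h2
      have hs' : (1 : ℝ) < s := by exact_mod_cast hs
      have h3 := (div_left_inj' (by linarith)).1 h2
      have h4 : r = r - s + 1 := by exact_mod_cast h3
      omega
    · exact eq_const_of_mem_representations hs hsr hr h1 h2
  · rintro rfl
    exact ⟨⟨fun n => by simp only [const]; omega, rfl⟩,
      Or.inr fun N => ⟨N, le_rfl, by simp only [const]; omega⟩⟩

theorem levelSet_zero {r s : ℕ} (hs : 1 < s) (hr : 1 ≤ r) : levelSet r s 0 = {0} := by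
  have h0 : ∀ b, value b (const 0) = 0 := fun b => by simp [value, const]
  suffices h : levelSet r s 0 = {value (r + 1) (const 0)} by rw [h, h0]
  rw [levelSet_eq_image hr, ← image_singleton]
  congr 1
  ext β
  constructor
  · rintro ⟨h1, -⟩
    exact funext (eq_zero_of_value_eq_zero hs h1.1 h1.2)
  · rintro rfl
    exact ⟨⟨fun n => Nat.zero_le _, h0 s⟩,
      Or.inr fun N => ⟨N, le_rfl, by simp only [const]; omega⟩⟩

theorem sq_mul_value {b c : ℕ} (hb : 1 < b) {α : ℕ → ℕ} (hα : ∀ n, α n ≤ c) :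
    (b : ℝ) * (b * value b α) = b * α 0 + α 1 + value b (fun n => α (n + 2)) := by
  have := mul_value hb (α := fun n => α (n + 1)) fun n => hα _
  simp only [zero_add] at this
  rw [mul_value hb hα, mul_add, this]
  ring

theorem word_one_zero (a b c : ℕ) : word 1 a b c 0 = a := by simp [word]

theorem word_one_one (a b c : ℕ) : word 1 a b c 1 = b := by simp [word]

theorem word_one_add_two (a b c : ℕ) : (fun n => word 1 a b c (n + 2)) = const c := by
  funext n
  simp [word, const]

theorem eq_word_one {β : ℕ → ℕ} {a b c : ℕ} (h0 : β 0 = a) (h1 : β 1 = b)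
    (h2 : (fun n => β (n + 2)) = const c) : β = word 1 a b c := by
  funext n
  match n with
  | 0 => rw [h0, word_one_zero]
  | 1 => rw [h1, word_one_one]
  | n + 2 =>
    rw [congrFun h2 n]
    exact (congrFun (word_one_add_two a b c) n).symm

/-- The only representations used by `f` of the value of `0 s (r - s + 1)`. -/
theorem classical_representations_pair {r s : ℕ} (hs : 1 < s) (hsr : s ≤ r) (hr : r < 2 * s - 2) :
    {α | α ∈ representations r s (value s (word 1 0 s (r - s + 1))) ∧ IsClassical r α} =
      {word 1 0 s (r - s + 1), word 1 1 0 (r - s + 1)} := by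
  have hs' : (1 : ℝ) < s := by exact_mod_cast hs
  have hs0 : (s : ℝ) ≠ 0 := by positivity
  set c := r - s + 1 with hc
  have w1 : ∀ n, word 1 0 s c n ≤ r := word_le (by omega) hsr (by omega)
  have w2 : ∀ n, word 1 1 0 c n ≤ r := word_le (by omega) (by omega) (by omega)
  have e1 := sq_mul_value hs w1
  have e2 := sq_mul_value hs w2
  rw [word_one_zero, word_one_one, word_one_add_two] at e1 e2
  push_cast at e1 e2
  ext β
  constructor
  · rintro ⟨⟨hβ, hv⟩, hcl⟩
    have e := sq_mul_value hs hβ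
    rw [hv, e1] at e
    set v := value s (const c) with hvdef
    set T := value s fun n => β (n + 2) with hT
    have hv1 : v = r / ((s : ℝ) - 1) - 1 := by
      have : (s : ℝ) - 1 ≠ 0 := by linarith
      rw [hvdef, value_const hs, hc, Nat.cast_add, Nat.cast_sub hsr, Nat.cast_one]
      field_simp
      ring
    have hvlt : v < 1 := by
      have h3 : (r : ℝ) + 2 < 2 * s := by exact_mod_cast (by omega : r + 2 < 2 * s)
      rw [hv1, sub_lt_iff_lt_add, div_lt_iff₀ (by linarith)]
      linarith
    have hT0 : 0 ≤ T := value_nonneg _ _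
    have hT1 : T ≤ r / ((s : ℝ) - 1) := value_le hs fun n => hβ _
    have tail : β 0 ≠ r → T = v → (fun n => β (n + 2)) = const c := by
      intro h0 h
      refine eq_const_of_mem_representations hs hsr hr ⟨fun n => hβ _, h⟩ fun N => ?_
      rcases hcl with h3 | h3
      · exact absurd (congrFun h3 0) h0
      · obtain ⟨n, hn, hne⟩ := h3 (N + 2)
        exact ⟨n - 2, by omega, by rwa [Nat.sub_add_cancel (by omega)]⟩
    -- From `s * β 0 + β 1 + T = s + v` with `v = M - 1 < 1` and `0 ≤ T ≤ M`, the first two digits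
    -- are `0 s`, `1 0` or `0 (s - 1)`. The last pair needs `T = M`, a tail `(r)`, which `f` does
    -- not use here; the other two need `T = v`, whose only admissible representation is constant.
    have hb : (β 1 : ℝ) + s * β 0 < s + 1 := by linarith
    have hb' : β 1 + s * β 0 < s + 1 := by exact_mod_cast hb
    have h01 : β 0 = 0 ∨ β 0 = 1 := by
      by_contra! hcon
      have : 2 ≤ β 0 := by omega
      have := Nat.mul_le_mul_left s this
      omega
    rcases h01 with h0 | h0
    · left
      rw [h0, Nat.cast_zero] at e
      have hlo : (s : ℝ) ≤ β 1 + 1 := by linarith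
      have hlo' : s ≤ β 1 + 1 := by exact_mod_cast hlo
      rw [h0] at hb'
      have h1 : β 1 = s ∨ β 1 + 1 = s := by omega
      rcases h1 with h1 | h1
      · refine eq_word_one h0 h1 (tail (by omega) ?_)
        rw [h1] at e
        linarith
      · exfalso
        have h4 : (β 1 : ℝ) + 1 = s := by exact_mod_cast h1
        have h5 : T = r / ((s : ℝ) - 1) := by linarith
        rcases hcl with h3 | h3
        · have := congrFun h3 0
          simp only [const] at this
          omega
        · obtain ⟨n, hn, hne⟩ := h3 2
          have := eq_const_of_value_eq_max hs (fun n => hβ _) h5 (n - 2)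
          rw [Nat.sub_add_cancel hn] at this
          exact hne this
    · right
      rw [h0] at e hb'
      have h1 : β 1 = 0 := by omega
      refine eq_word_one h0 h1 (tail (by omega) ?_)
      rw [h1] at e
      push_cast at e
      linarith
  · have hcl : ∀ a b, IsClassical r (word 1 a b c) := fun a b =>
      Or.inr fun N => ⟨N + 2, by omega, by
        rw [congrFun (word_one_add_two a b c) N]
        simp only [const]
        omega⟩
    rintro (rfl | rfl)
    · exact ⟨⟨w1, rfl⟩, hcl _ _⟩
    · refine ⟨⟨w2, mul_left_cancel₀ hs0 (mul_left_cancel₀ hs0 ?_)⟩, hcl _ _⟩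
      rw [e1, e2]
      ring

theorem exists_finite_nontrivial_levelSet {r s : ℕ} (hs : 1 < s) (hsr : s ≤ r)
    (hr : r < 2 * s - 2) : ∃ y, (levelSet r s y).Finite ∧ (levelSet r s y).Nontrivial := by
  have hset := classical_representations_pair hs hsr hr
  have hinj := injOn_value (r := r) (by omega) s (value s (word 1 0 s (r - s + 1)))
  refine ⟨value s (word 1 0 s (r - s + 1)), ?_⟩
  rw [levelSet_eq_image (by omega)]
  rw [hset] at hinj ⊢
  refine ⟨(toFinite _).image _, hinj.image_nontrivial_iff.2 (nontrivial_pair fun h => ?_)⟩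
  have := congrFun h 0
  rw [word_one_zero, word_one_zero] at this
  omega

end RedundantDigits

theorem mainTheorem1 (r s : ℕ) (hs : 1 < s) (hsr : s ≤ r) (hr : r < 2 * s - 1) :
    -- a singleton level set
    (∃ y : ℝ, ∃ x : ℝ, RedundantDigits.levelSet r s y = {x}) ∧
    -- a finite level set with at least two points (none exists for `r = 2 * s - 2`)
    (r < 2 * s - 2 → ∃ y : ℝ, (RedundantDigits.levelSet r s y).Finite ∧
      (RedundantDigits.levelSet r s y).Nontrivial) ∧
    -- a countably infinite level set, at the value with representation `(s - 1)`
    Cardinal.mk (RedundantDigits.levelSet r s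
      (RedundantDigits.value s (RedundantDigits.const (s - 1)))) = Cardinal.aleph0 ∧
    -- a level set of the cardinality of the continuum
    (∃ y : ℝ, Cardinal.mk (RedundantDigits.levelSet r s y) = Cardinal.continuum) ∧
    -- a level set of positive Hausdorff dimension
    (∃ y : ℝ, 0 < dimH (RedundantDigits.levelSet r s y)) ∧
    -- the Hausdorff dimension of the set of values with finite or countable level sets
    dimH {y : ℝ | y ∈ RedundantDigits.f r s '' Set.Icc (0 : ℝ) 1 ∧
        (RedundantDigits.levelSet r s y).Countable} =
      ENNReal.ofReal (Real.log (2 * (s : ℝ) - (r : ℝ) - 1) / Real.log (s : ℝ)) ∧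
    -- all representations of the value with representation `(s - 1)`
    RedundantDigits.representations r s
        (RedundantDigits.value s (RedundantDigits.const (s - 1))) =
      {α | α = RedundantDigits.const (s - 1) ∨
        (∃ k : ℕ, α = RedundantDigits.word k (s - 1) s 0) ∨
        (r = 2 * s - 2 ∧ ∃ k : ℕ, α = RedundantDigits.word k (s - 1) (s - 2) r)} ∧
    Cardinal.mk (RedundantDigits.representations r s
      (RedundantDigits.value s (RedundantDigits.const (s - 1)))) = Cardinal.aleph0 ∧
    -- all representations of the value with representation `(r - s + 1)`
    RedundantDigits.representations r s
        (RedundantDigits.value s (RedundantDigits.const (r - s + 1))) =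
      {α | α = RedundantDigits.const (r - s + 1) ∨
        (∃ k : ℕ, α = RedundantDigits.word k (r - s + 1) (r - s) r) ∨
        (r = 2 * s - 2 ∧ ∃ k : ℕ, α = RedundantDigits.word k (r - s + 1) (r - s + 2) 0)} ∧
    Cardinal.mk (RedundantDigits.representations r s
      (RedundantDigits.value s (RedundantDigits.const (r - s + 1)))) = Cardinal.aleph0 ∧
    -- the level set at that value: the representations with period `(r)` are not used by `f`
    (r < 2 * s - 2 → RedundantDigits.levelSet r s
        (RedundantDigits.value s (RedundantDigits.const (r - s + 1))) =
      {RedundantDigits.value (r + 1) (RedundantDigits.const (r - s + 1))}) ∧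
    (r = 2 * s - 2 → Cardinal.mk (RedundantDigits.levelSet r s
      (RedundantDigits.value s (RedundantDigits.const (r - s + 1)))) = Cardinal.aleph0) := by
  have hr' : r ≤ 2 * s - 2 := by omega
  refine ⟨⟨0, 0, RedundantDigits.levelSet_zero hs (by omega)⟩,
    RedundantDigits.exists_finite_nontrivial_levelSet hs hsr,
    RedundantDigits.mk_levelSet_const_max hs hsr hr',
    ⟨_, RedundantDigits.mk_levelSet_eq_continuum hs hsr⟩,
    ⟨_, RedundantDigits.dimH_levelSet_pos hs hsr⟩,
    RedundantDigits.dimH_countable_levelSet hs hsr hr',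
    RedundantDigits.representations_const_max hs hsr hr',
    RedundantDigits.mk_representations_const_max hs hsr hr',
    RedundantDigits.representations_const_min hs hsr hr',
    RedundantDigits.mk_representations_const_min hs hsr hr',
    RedundantDigits.levelSet_const_min hs hsr, fun h => ?_⟩
  rw [show r - s + 1 = s - 1 by omega]
  exact RedundantDigits.mk_levelSet_const_max hs hsr hr'
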